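/- Let $g:\mathbb{C}\to\mathbb{C}$ be an entire function, let $M(r)=\sup_{|z|\le r}|g(z)|$, and let $\rho=\limsup_{r\to\infty}\frac{\ln\ln M(r)}{\ln r}\in[0,\infty]$ be its order (with $\rho=0$ if $g$ is constant). Put $a_n(z)=g^{(n)}(z)/n!$ and, for $z\in\mathbb{C}$, $$\rho_0(z)=\limsup_{k\to\infty}\frac{2k\ln(2k)}{-\ln|a_{2k}(z)|},\qquad \rho_1(z)=\limsup_{k\to\infty}\frac{(2k+1)\ln(2k+1)}{-\ln|a_{2k+1}(z)|},$$ where a quotient is read as $0$ if the coefficient in it vanishes. Let $\theta=e^{1-1/\rho}$, $\theta_0(z)=e^{1-1/\rho_0(z)}$ and $\theta_1(z)=e^{1-1/\rho_1(z)}$, where $e^{1-1/0}=0$ and $e^{1-1/\infty}=e$. Then for every $z\in\mathbb{C}$ $$\theta=\limsup_{n\to\infty}|g^{(n)}(z)|^{\frac{1}{n\ln n}},\qquad \theta_0(z)=\limsup_{k\to\infty}|g^{(2k)}(z)|^{\frac{1}{2k\ln k}},\qquad \theta_1(z)=\limsup_{k\to\infty}|g^{(2k+1)}(z)|^{\frac{1}{2k\ln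 k}},$$ and for almost every $z\in\mathbb{C}$ (with respect to Lebesgue measure) $$\theta_0(z)=\theta\quad\text{and}\quad\theta_1(z)=\theta .$$ Equivalently, $\rho_0(z)=\rho_1(z)=\rho$ for almost every $z\in\mathbb{C}$. -/

import Mathlib

open Filter MeasureTheory
open scoped ENNReal

noncomputable section

namespace EntireFn

/-- The maximum modulus `M(r) = sup_{|z| ≤ r} |g(z)|`. -/
def maxModulus (g : ℂ → ℂ) (r : ℝ) : ℝ :=
  sSup ((fun z : ℂ => ‖g z‖) '' Metric.closedBall 0 r)

/-- The order `ρ(g) = limsup_{r → ∞} ln ln M(r) / ln r ∈ [0, ∞]`. The positive parts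
`log⁺ = max 0 log` change nothing for large `r` when `g` is not constant; for constant `g`
they give the conventional value `0`. -/
def order (g : ℂ → ℂ) : ℝ≥0∞ :=
  limsup (fun r : ℝ =>
    ENNReal.ofReal (Real.posLog (Real.posLog (maxModulus g r)) / Real.log r)) atTop

/-- The Taylor coefficient `a_n(z) = g^{(n)}(z) / n!` of `g` at the point `z`. -/
def taylorCoeff (g : ℂ → ℂ) (n : ℕ) (z : ℂ) : ℂ :=
  iteratedDeriv n g z / (n.factorial : ℂ)

/-- The quotient `n ln n / (- ln |a_n(z)|)`. It is `0` when `a_n(z) = 0`, in agreement with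
`- ln 0 = +∞`. For entire `g` one has `|a_n(z)| < 1` for all large `n`, so that the other
degenerate cases (denominator zero or negative) occur for finitely many `n` only. -/
def orderQuotient (g : ℂ → ℂ) (n : ℕ) (z : ℂ) : ℝ≥0∞ :=
  ENNReal.ofReal ((n : ℝ) * Real.log n / (-Real.log ‖taylorCoeff g n z‖))

/-- `ρ₀(z) = limsup_k 2k ln(2k) / (- ln |a_{2k}(z)|)`. -/
def orderEven (g : ℂ → ℂ) (z : ℂ) : ℝ≥0∞ :=
  limsup (fun k : ℕ => orderQuotient g (2 * k) z) atTop

/-- `ρ₁(z) = limsup_k (2k+1) ln(2k+1) / (- ln |a_{2k+1}(z)|)`. -/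
def orderOdd (g : ℂ → ℂ) (z : ℂ) : ℝ≥0∞ :=
  limsup (fun k : ℕ => orderQuotient g (2 * k + 1) z) atTop

/-- `ρ ↦ e^{1 - 1/ρ}` on `[0, ∞]`, with value `e^{-∞} = 0` at `ρ = 0` and `e` at `ρ = ∞`. -/
def theta (ρ : ℝ≥0∞) : ℝ≥0∞ :=
  EReal.exp (1 - ((ρ⁻¹ : ℝ≥0∞) : EReal))

/-- `limsup_n |g^{(n)}(z)|^{1/(n ln n)}`. -/
def derivLimsup (g : ℂ → ℂ) (z : ℂ) : ℝ≥0∞ :=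
  limsup (fun n : ℕ => ‖iteratedDeriv n g z‖ₑ ^ (1 / ((n : ℝ) * Real.log n))) atTop

/-- `limsup_k |g^{(2k)}(z)|^{1/(2k ln k)}`. -/
def derivLimsupEven (g : ℂ → ℂ) (z : ℂ) : ℝ≥0∞ :=
  limsup (fun k : ℕ => ‖iteratedDeriv (2 * k) g z‖ₑ ^ (1 / (2 * (k : ℝ) * Real.log k))) atTop

/-- `limsup_k |g^{(2k+1)}(z)|^{1/(2k ln k)}`. -/
def derivLimsupOdd (g : ℂ → ℂ) (z : ℂ) : ℝ≥0∞ :=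
  limsup (fun k : ℕ => ‖iteratedDeriv (2 * k + 1) g z‖ₑ ^ (1 / (2 * (k : ℝ) * Real.log k))) atTop

end EntireFn

end

/-! Growth is measured by the exponents `t` for which `|g^(n)(z)| ≤ exp(t n ln n)` for large `n`.
Since `ln n! = n ln n + O(n)`, dividing by `n!` lowers the exponent by 1, and `t = 1 - 1/σ` for
order `σ`; as `theta` is continuous and increasing, this links roots of derivatives with coefficient
quotients (`limsup_root_eq_theta_limsup`). Cauchy's estimates bound the derivatives by the order,
uniformly on bounded sets; conversely, summing the Taylor series at one point bounds the order.

For the almost-everywhere claim, let `theta (order g) = e^τ` and suppose that the derivatives of one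
parity have exponent `t < τ` on a set of positive area. On a subset of positive area this holds from
a common index on. The logarithm of `|g^(n)|` is subharmonic, so a two-constants estimate combines
this bound with the global exponent, slightly above `τ`, into an exponent below `τ` on the unit disc
(`theta_order_le_of_measure_ne_zero`). Cauchy's estimate for one more derivative transfers it to the
other parity, so all derivatives at 0 have exponent below `τ`, a contradiction. -/

/-! ### Exponential bounds, and asymptotics of `n ln n`. -/

theorem ENNReal.le_of_forall_lt_exp {a b : ℝ≥0∞}
    (h : ∀ t : ℝ, b < ENNReal.ofReal (Real.exp t) → a ≤ ENNReal.ofReal (Real.exp t)) : a ≤ b := by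
  refine le_of_forall_gt_imp_ge_of_dense fun c hc => ?_
  obtain ⟨r, h0, h1, h2⟩ := ENNReal.lt_iff_exists_real_btwn.1 hc
  have hr : 0 < r := ENNReal.ofReal_pos.1 (bot_le.trans_lt h1)
  have := h (Real.log r)
  rw [Real.exp_log hr] at this
  exact (this h1).trans h2.le

theorem ENNReal.exists_exp_btwn {a b : ℝ≥0∞} (h : a < b) :
    ∃ t : ℝ, a < ENNReal.ofReal (Real.exp t) ∧ ENNReal.ofReal (Real.exp t) < b := by
  obtain ⟨r, h0, h1, h2⟩ := ENNReal.lt_iff_exists_real_btwn.1 h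
  have hr : 0 < r := ENNReal.ofReal_pos.1 (bot_le.trans_lt h1)
  exact ⟨Real.log r, by rwa [Real.exp_log hr], by rwa [Real.exp_log hr]⟩

theorem ofReal_exp_lt_ofReal_exp {s t : ℝ} :
    ENNReal.ofReal (Real.exp s) < ENNReal.ofReal (Real.exp t) ↔ s < t := by
  rw [ENNReal.ofReal_lt_ofReal_iff (Real.exp_pos t), Real.exp_lt_exp]

theorem enorm_rpow_one_div_le_iff {p : ℂ} {m t : ℝ} (hm : 0 < m) :
    ‖p‖ₑ ^ (1 / m) ≤ ENNReal.ofReal (Real.exp t) ↔ ‖p‖ ≤ Real.exp (t * m) := by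
  rw [one_div, ENNReal.rpow_inv_le_iff hm, ENNReal.ofReal_rpow_of_pos (Real.exp_pos t),
    ← Real.exp_mul, ← ofReal_norm, ENNReal.ofReal_le_ofReal_iff (Real.exp_pos _).le]

theorem limsup_root_le {p : ℕ → ℂ} {m : ℕ → ℝ} (hm : ∀ᶠ k in atTop, 0 < m k) {t : ℝ}
    (h : ∀ᶠ k in atTop, ‖p k‖ ≤ Real.exp (t * m k)) :
    limsup (fun k => ‖p k‖ₑ ^ (1 / m k)) atTop ≤ ENNReal.ofReal (Real.exp t) := by
  refine limsup_le_of_le (by isBoundedDefault) ?_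
  filter_upwards [hm, h] with k h1 h2
  exact (enorm_rpow_one_div_le_iff h1).2 h2

theorem eventually_norm_le_of_limsup_root_lt {p : ℕ → ℂ} {m : ℕ → ℝ}
    (hm : ∀ᶠ k in atTop, 0 < m k) {t : ℝ}
    (h : limsup (fun k => ‖p k‖ₑ ^ (1 / m k)) atTop < ENNReal.ofReal (Real.exp t)) :
    ∀ᶠ k in atTop, ‖p k‖ ≤ Real.exp (t * m k) := by
  filter_upwards [hm, eventually_lt_of_limsup_lt h] with k h1 h2
  exact (enorm_rpow_one_div_le_iff h1).1 h2.le

/-- Asymptotically equal weights are interchangeable at the cost of an arbitrarily small increase of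
the exponent; this allows passing between `2k ln k` and `n ln n`. -/
theorem eventually_norm_le_exp_of_weight_ratio {p : ℕ → ℂ} {m w : ℕ → ℝ}
    (hw : ∀ᶠ k in atTop, 0 < w k) (hmw : Tendsto (fun k => m k / w k) atTop (nhds 1))
    {t t' : ℝ} (htt : t < t') (h : ∀ᶠ k in atTop, ‖p k‖ ≤ Real.exp (t * m k)) :
    ∀ᶠ k in atTop, ‖p k‖ ≤ Real.exp (t' * w k) := by
  have h1 : Tendsto (fun k => t * (m k / w k)) atTop (nhds t) := by
    simpa using hmw.const_mul t
  filter_upwards [hw, h, h1.eventually (gt_mem_nhds htt)] with k hk h2 h3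
  refine h2.trans (Real.exp_le_exp.2 ?_)
  rw [← mul_div_assoc, div_lt_iff₀ hk] at h3
  exact h3.le

theorem eventually_natCast_mul_log_pos {n : ℕ → ℕ} (hn : Tendsto n atTop atTop) :
    ∀ᶠ k in atTop, 0 < (n k : ℝ) * Real.log (n k) := by
  filter_upwards [hn.eventually_ge_atTop 2] with k hk
  have : (2 : ℝ) ≤ n k := by exact_mod_cast hk
  exact mul_pos (by linarith) (Real.log_pos (by linarith))

theorem eventually_mul_add_le_natCast_mul_log {s t : ℝ} (hst : s < t) (C D : ℝ) :
    ∀ᶠ n : ℕ in atTop, s * ((n : ℝ) * Real.log n) + C * n + D ≤ t * ((n : ℝ) * Real.log n) := by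
  have hl : Tendsto (fun n : ℕ => Real.log n) atTop atTop :=
    Real.tendsto_log_atTop.comp tendsto_natCast_atTop_atTop
  filter_upwards [hl.eventually_ge_atTop ((|C| + |D|) / (t - s)), eventually_ge_atTop 1] with n h h1
  have h1' : (1 : ℝ) ≤ n := by exact_mod_cast h1
  rw [div_le_iff₀ (by linarith)] at h
  nlinarith [le_abs_self C, le_abs_self D, mul_le_mul_of_nonneg_left h (by linarith : (0:ℝ) ≤ n),
    abs_nonneg C, abs_nonneg D]

theorem natCast_factorial_le_exp_mul_log (n : ℕ) :
    (n.factorial : ℝ) ≤ Real.exp ((n : ℝ) * Real.log n) := by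
  rcases Nat.eq_zero_or_pos n with rfl | hn
  · simp
  · rw [mul_comm, Real.exp_mul, Real.exp_log (by exact_mod_cast hn), Real.rpow_natCast]
    exact_mod_cast Nat.factorial_le_pow n

/-- The number `n^n / n!` is one term of the series for `e^n`. -/
theorem exp_mul_log_le_natCast_factorial_mul_exp (n : ℕ) :
    Real.exp ((n : ℝ) * Real.log n) ≤ n.factorial * Real.exp n := by
  rcases Nat.eq_zero_or_pos n with rfl | hn
  · simp
  · rw [mul_comm, Real.exp_mul, Real.exp_log (by exact_mod_cast hn), Real.rpow_natCast]
    have := Real.pow_div_factorial_le_exp (n : ℝ) (by positivity) n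
    rwa [div_le_iff₀ (by positivity), mul_comm] at this

theorem tendsto_mul_log_ratio (j : ℕ) :
    Tendsto (fun k : ℕ => (((2 * k + j : ℕ) : ℝ) * Real.log (2 * k + j : ℕ)) /
      (2 * (k : ℝ) * Real.log k)) atTop (nhds 1) := by
  have hl : Tendsto (fun n : ℕ => Real.log n) atTop atTop :=
    Real.tendsto_log_atTop.comp tendsto_natCast_atTop_atTop
  have h0 : Tendsto (fun k : ℕ => (j : ℝ) / k) atTop (nhds 0) :=
    tendsto_const_nhds.div_atTop tendsto_natCast_atTop_atTop
  have h1 : Tendsto (fun k : ℕ => Real.log (2 + (j : ℝ) / k)) atTop (nhds (Real.log 2)) := by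
    refine Tendsto.log ?_ (by norm_num)
    simpa using h0.const_add 2
  have h2 : Tendsto (fun k : ℕ => 1 + Real.log (2 + (j : ℝ) / k) / Real.log k) atTop (nhds 1) := by
    simpa using (h1.div_atTop hl).const_add 1
  have h3 : Tendsto (fun k : ℕ => 1 + (j : ℝ) / k / 2) atTop (nhds 1) := by
    simpa using (h0.div_const 2).const_add 1
  have h4 := h3.mul h2
  rw [one_mul] at h4
  refine h4.congr' ?_
  filter_upwards [eventually_ge_atTop 2] with k hk
  have hk' : (2 : ℝ) ≤ k := by exact_mod_cast hk
  have hlk : 0 < Real.log k := Real.log_pos (by linarith)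
  have hk0 : (k : ℝ) ≠ 0 := by positivity
  have e : ((2 * k + j : ℕ) : ℝ) = k * (2 + j / k) := by push_cast; field_simp
  rw [e, Real.log_mul hk0 (by positivity)]
  field_simp

/-! ### The function `theta`: roots of derivatives versus coefficient quotients. -/

namespace EntireFn

theorem theta_strictMono : StrictMono theta := by
  intro a b hab
  unfold theta
  rw [EReal.exp_lt_exp_iff]
  have : ((b⁻¹ : ℝ≥0∞) : EReal) < ((a⁻¹ : ℝ≥0∞) : EReal) := by
    rw [EReal.coe_ennreal_lt_coe_ennreal_iff]; exact ENNReal.inv_lt_inv.2 hab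
  rw [sub_eq_add_neg, sub_eq_add_neg]
  exact EReal.add_lt_add_left_coe (EReal.neg_lt_neg_iff.2 this) 1

theorem continuous_theta : Continuous theta := by
  have h1 : Continuous fun ρ : ℝ≥0∞ => -((ρ⁻¹ : ℝ≥0∞) : EReal) :=
    (continuous_coe_ennreal_ereal.comp continuous_inv).neg
  have h : Continuous fun ρ : ℝ≥0∞ => (1 : EReal) + -((ρ⁻¹ : ℝ≥0∞) : EReal) := by
    refine continuous_iff_continuousAt.2 fun x => ?_
    have h2 := EReal.continuousAt_add (p := (1, -((x⁻¹ : ℝ≥0∞) : EReal)))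
      (Or.inl (EReal.coe_ne_top 1)) (Or.inl (EReal.coe_ne_bot 1))
    exact ContinuousAt.comp (f := fun ρ : ℝ≥0∞ => ((1 : EReal), -((ρ⁻¹ : ℝ≥0∞) : EReal))) h2
      (continuousAt_const.prodMk h1.continuousAt)
  exact ENNReal.continuous_exp.comp h

theorem theta_top : theta ⊤ = ENNReal.ofReal (Real.exp 1) := by
  simp only [theta, ENNReal.inv_top, EReal.coe_ennreal_zero, sub_zero]
  exact EReal.exp_coe 1

theorem theta_zero : theta 0 = 0 := by
  simp [theta]

theorem theta_ofReal {σ : ℝ} (h : 0 < σ) :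
    theta (ENNReal.ofReal σ) = ENNReal.ofReal (Real.exp (1 - 1 / σ)) := by
  rw [theta, ← ENNReal.ofReal_inv_of_pos h, EReal.coe_ennreal_ofReal, max_eq_left (by positivity),
    one_div]
  exact EReal.exp_coe (1 - σ⁻¹)

theorem theta_le (ρ : ℝ≥0∞) : theta ρ ≤ ENNReal.ofReal (Real.exp 1) :=
  theta_top ▸ theta_strictMono.monotone le_top

theorem theta_inv_one_sub {t : ℝ} (ht : t < 1) :
    theta (ENNReal.ofReal (1 / (1 - t))) = ENNReal.ofReal (Real.exp t) := by
  rw [theta_ofReal (one_div_pos.2 (by linarith)), one_div_one_div]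
  congr 2; ring

theorem theta_limsup (q : ℕ → ℝ≥0∞) :
    theta (limsup q atTop) = limsup (fun k => theta (q k)) atTop :=
  theta_strictMono.monotone.map_limsup_of_continuousAt q continuous_theta.continuousAt

theorem theta_ofReal_div_neg_log_le_iff {a : ℂ} (ha : ‖a‖ < 1) {w t : ℝ} (hw : 0 < w) :
    theta (ENNReal.ofReal (w / (-Real.log ‖a‖))) ≤ ENNReal.ofReal (Real.exp t) ↔
      ‖a‖ ≤ Real.exp ((t - 1) * w) := by
  rcases eq_or_ne a 0 with rfl | h0
  -- For a vanishing coefficient the conventions `log 0 = 0` and `w / 0 = 0` make the quotient 0, as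
  -- intended.
  · simp [theta_zero, Real.exp_nonneg]
  · have hpos : 0 < ‖a‖ := norm_pos_iff.2 h0
    have hl : 0 < -Real.log ‖a‖ := neg_pos.2 (Real.log_neg hpos ha)
    rw [theta_ofReal (by positivity), ENNReal.ofReal_le_ofReal_iff (Real.exp_nonneg _),
      Real.exp_le_exp, ← Real.log_le_iff_le_exp hpos, one_div_div, sub_le_iff_le_add,
      ← sub_le_iff_le_add', le_div_iff₀ hw]
    constructor <;> intro h <;> linarith

/-- The `limsup` of the `n ln n`-th roots of the derivatives is `theta` of the `limsup` of the
quotients formed with the Taylor coefficients. -/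
theorem limsup_root_eq_theta_limsup {p : ℕ → ℂ} {n : ℕ → ℕ} {m : ℕ → ℝ}
    (hn : Tendsto n atTop atTop) (hm : ∀ᶠ k in atTop, 0 < m k)
    (hnm : Tendsto (fun k => ((n k : ℝ) * Real.log (n k)) / m k) atTop (nhds 1))
    (ha : ∀ᶠ k in atTop, ‖p k / ((n k).factorial : ℂ)‖ < 1) :
    limsup (fun k => ‖p k‖ₑ ^ (1 / m k)) atTop =
      theta (limsup (fun k => ENNReal.ofReal ((n k : ℝ) * Real.log (n k) /
        (-Real.log ‖p k / ((n k).factorial : ℂ)‖))) atTop) := by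
  have hw := eventually_natCast_mul_log_pos hn
  have hmn : Tendsto (fun k => m k / ((n k : ℝ) * Real.log (n k))) atTop (nhds 1) := by
    simpa using hnm.inv₀ one_ne_zero
  have hnorm : ∀ k, ‖p k / ((n k).factorial : ℂ)‖ = ‖p k‖ / (n k).factorial := by
    intro k; simp
  rw [theta_limsup]
  apply le_antisymm
  · refine ENNReal.le_of_forall_lt_exp fun t ht => ?_
    obtain ⟨s, hs, hst⟩ := ENNReal.exists_exp_btwn ht
    rw [ofReal_exp_lt_ofReal_exp] at hst
    refine limsup_root_le hm (eventually_norm_le_exp_of_weight_ratio hm hnm hst ?_)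
    filter_upwards [hw, ha, eventually_lt_of_limsup_lt hs] with k h1 h2 h3
    have h4 := (theta_ofReal_div_neg_log_le_iff h2 h1).1 h3.le
    rw [hnorm, div_le_iff₀ (by positivity)] at h4
    refine h4.trans ((mul_le_mul_of_nonneg_left (natCast_factorial_le_exp_mul_log (n k))
      (Real.exp_nonneg _)).trans_eq ?_)
    rw [← Real.exp_add]; ring_nf
  · refine ENNReal.le_of_forall_lt_exp fun t ht => ?_
    obtain ⟨s, hs, hst⟩ := ENNReal.exists_exp_btwn ht
    -- Two gaps are needed: from `s` to `s'` the weight changes, and from `s'` to `t` the factor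
    -- `e^n` in the bound for `n!` is absorbed.
    obtain ⟨s', hs', hst'⟩ := ENNReal.exists_exp_btwn hst
    rw [ofReal_exp_lt_ofReal_exp] at hs' hst'
    have h0 := eventually_norm_le_exp_of_weight_ratio hw hmn hs'
      (eventually_norm_le_of_limsup_root_lt hm hs)
    refine limsup_le_of_le (by isBoundedDefault) ?_
    filter_upwards [hw, ha, h0, hn.eventually (eventually_mul_add_le_natCast_mul_log hst' 1 0)]
      with k h1 h2 h3 h4
    rw [theta_ofReal_div_neg_log_le_iff h2 h1, hnorm, div_le_iff₀ (by positivity)]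
    have h5 := exp_mul_log_le_natCast_factorial_mul_exp (n k)
    refine h3.trans ?_
    calc Real.exp (s' * ((n k : ℝ) * Real.log (n k)))
        ≤ Real.exp ((t - 1) * ((n k : ℝ) * Real.log (n k)) - n k)
          * Real.exp ((n k : ℝ) * Real.log (n k)) := by
          rw [← Real.exp_add, Real.exp_le_exp]; linarith
      _ ≤ Real.exp ((t - 1) * ((n k : ℝ) * Real.log (n k)) - n k)
          * ((n k).factorial * Real.exp (n k)) := by gcongr
      _ = Real.exp ((t - 1) * ((n k : ℝ) * Real.log (n k))) * (n k).factorial := by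
          rw [Real.exp_sub]; field_simp

end EntireFn

/-! ### The order and the growth of all derivatives. -/

namespace EntireFn

theorem norm_le_maxModulus {g : ℂ → ℂ} (hg : Continuous g) {r : ℝ} {z : ℂ} (hz : ‖z‖ ≤ r) :
    ‖g z‖ ≤ maxModulus g r := by
  refine le_csSup ?_ ⟨z, by simpa using hz, rfl⟩
  exact ((isCompact_closedBall (0 : ℂ) r).image hg.norm).bddAbove

theorem maxModulus_nonneg (g : ℂ → ℂ) (r : ℝ) : 0 ≤ maxModulus g r :=
  Real.sSup_nonneg (by rintro _ ⟨z, -, rfl⟩; exact norm_nonneg _)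

theorem maxModulus_le {g : ℂ → ℂ} {r b : ℝ} (hb : 0 ≤ b) (h : ∀ z, ‖z‖ ≤ r → ‖g z‖ ≤ b) :
    maxModulus g r ≤ b :=
  Real.sSup_le (by rintro _ ⟨z, hz, rfl⟩; exact h z (by simpa using hz)) hb

theorem eventually_maxModulus_le_of_order_lt {g : ℂ → ℂ} {σ : ℝ}
    (h : order g < ENNReal.ofReal σ) :
    ∀ᶠ r : ℝ in atTop, maxModulus g r ≤ Real.exp (r ^ σ) := by
  have hσ : 0 < σ := ENNReal.ofReal_pos.1 (bot_le.trans_lt h)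
  filter_upwards [eventually_lt_of_limsup_lt h, eventually_gt_atTop 1] with r h1 hr
  rw [ENNReal.ofReal_lt_ofReal_iff hσ, div_lt_iff₀ (Real.log_pos hr)] at h1
  rcases (maxModulus_nonneg g r).eq_or_lt with h0 | h0
  · rw [← h0]; exact Real.exp_nonneg _
  rw [← Real.log_le_iff_le_exp h0]
  by_contra! hlt
  have hr0 : 0 < r ^ σ := Real.rpow_pos_of_pos (by linarith) σ
  have h2 : r ^ σ < Real.posLog (maxModulus g r) := hlt.trans_le (le_max_right _ _)
  have h3 : Real.log (r ^ σ) < Real.posLog (Real.posLog (maxModulus g r)) :=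
    (Real.log_lt_log hr0 h2).trans_le (le_max_right _ _)
  rw [Real.log_rpow (by linarith)] at h3
  linarith

theorem order_le_of_eventually_maxModulus_le {g : ℂ → ℂ} {σ : ℝ} (hσ : 0 < σ)
    (h : ∀ᶠ r : ℝ in atTop, maxModulus g r ≤ Real.exp (r ^ σ)) :
    order g ≤ ENNReal.ofReal σ := by
  refine limsup_le_of_le (by isBoundedDefault) ?_
  filter_upwards [h, eventually_gt_atTop 1] with r h1 hr
  refine ENNReal.ofReal_le_ofReal ?_
  rw [div_le_iff₀ (Real.log_pos hr)]
  have hr1 : 1 ≤ r ^ σ := Real.one_le_rpow hr.le hσ.le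
  have h2 : Real.posLog (maxModulus g r) ≤ r ^ σ := by
    refine (Real.posLog_le_posLog (maxModulus_nonneg g r) h1).trans ?_
    rw [Real.posLog, Real.log_exp]
    exact max_le (by linarith) le_rfl
  refine (Real.posLog_le_posLog Real.posLog_nonneg h2).trans ?_
  rw [Real.posLog, Real.log_rpow (by linarith)]
  exact max_le (mul_nonneg hσ.le (Real.log_nonneg hr.le)) le_rfl

theorem norm_iteratedDeriv_le_maxModulus {g : ℂ → ℂ} (hg : Differentiable ℂ g) (n : ℕ) {z : ℂ}
    {K r : ℝ} (hr : 0 < r) (hz : ‖z‖ ≤ K) :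
    ‖iteratedDeriv n g z‖ ≤ n.factorial * maxModulus g (K + r) / r ^ n := by
  refine Complex.norm_iteratedDeriv_le_of_forall_mem_sphere_norm_le n hr hg.diffContOnCl
    fun w hw => norm_le_maxModulus hg.continuous ?_
  have : ‖w - z‖ = r := by simpa [dist_eq_norm] using hw
  calc ‖w‖ = ‖z + (w - z)‖ := by ring_nf
    _ ≤ ‖z‖ + ‖w - z‖ := norm_add_le _ _
    _ ≤ K + r := by linarith

/-- Cauchy's estimate with radius `n^(1/σ)`: there the maximum modulus is only `e^{O(n)}`, while
dividing by the `n`-th power of the radius lowers the exponent by `1/σ`. -/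
theorem eventually_norm_iteratedDeriv_le_of_order_lt {g : ℂ → ℂ} (hg : Differentiable ℂ g)
    {σ t : ℝ} (hσ : order g < ENNReal.ofReal σ) (ht : 1 - 1 / σ < t) (K : ℝ) :
    ∀ᶠ n : ℕ in atTop, ∀ z : ℂ, ‖z‖ ≤ K →
      ‖iteratedDeriv n g z‖ ≤ Real.exp (t * ((n : ℝ) * Real.log n)) := by
  have hσ0 : 0 < σ := ENNReal.ofReal_pos.1 (bot_le.trans_lt hσ)
  have hR : Tendsto (fun n : ℕ => (n : ℝ) ^ (1 / σ)) atTop atTop :=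
    (tendsto_rpow_atTop (by positivity)).comp tendsto_natCast_atTop_atTop
  filter_upwards [(tendsto_atTop_add_const_left _ K hR).eventually
      (eventually_maxModulus_le_of_order_lt hσ), hR.eventually_ge_atTop K, eventually_gt_atTop 0,
      eventually_mul_add_le_natCast_mul_log ht (2 ^ σ) 0, hR.eventually_ge_atTop (-K)]
    with n h1 h2 h3 h4 h5 z hz
  have hn : (0 : ℝ) < n := by exact_mod_cast h3
  set R : ℝ := (n : ℝ) ^ (1 / σ) with hRdef
  have hR0 : 0 < R := Real.rpow_pos_of_pos hn _
  refine (norm_iteratedDeriv_le_maxModulus hg n hR0 hz).trans ?_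
  have h6 : (K + R) ^ σ ≤ 2 ^ σ * n := by
    calc (K + R) ^ σ ≤ (2 * R) ^ σ := Real.rpow_le_rpow (by linarith) (by linarith) hσ0.le
      _ = 2 ^ σ * n := by
        rw [Real.mul_rpow (by norm_num) hR0.le, hRdef, ← Real.rpow_mul hn.le,
          one_div_mul_cancel hσ0.ne', Real.rpow_one]
  have h7 : R ^ n = Real.exp (1 / σ * ((n : ℝ) * Real.log n)) := by
    rw [hRdef, ← Real.rpow_natCast, ← Real.rpow_mul hn.le, Real.rpow_def_of_pos hn]
    ring_nf
  rw [h7, div_le_iff₀ (Real.exp_pos _), ← Real.exp_add]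
  calc (n.factorial : ℝ) * maxModulus g (K + R)
      ≤ Real.exp ((n : ℝ) * Real.log n) * Real.exp (2 ^ σ * n) :=
        mul_le_mul (natCast_factorial_le_exp_mul_log n) (h1.trans (Real.exp_le_exp.2 h6))
          (maxModulus_nonneg _ _) (Real.exp_nonneg _)
    _ ≤ _ := by
        rw [← Real.exp_add, Real.exp_le_exp]; linarith

/-- Covers exponents not of the form `1 - 1/σ`; radius 1 suffices, as `n!` has exponent at most 1.
-/
theorem eventually_norm_iteratedDeriv_le_of_one_lt {g : ℂ → ℂ} (hg : Differentiable ℂ g)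
    {t : ℝ} (ht : 1 < t) (K : ℝ) :
    ∀ᶠ n : ℕ in atTop, ∀ z : ℂ, ‖z‖ ≤ K →
      ‖iteratedDeriv n g z‖ ≤ Real.exp (t * ((n : ℝ) * Real.log n)) := by
  filter_upwards [eventually_mul_add_le_natCast_mul_log ht 0 (maxModulus g (K + 1))] with n h z hz
  refine (norm_iteratedDeriv_le_maxModulus hg n one_pos hz).trans ?_
  rw [one_pow, div_one]
  calc (n.factorial : ℝ) * maxModulus g (K + 1)
      ≤ Real.exp ((n : ℝ) * Real.log n) * Real.exp (maxModulus g (K + 1)) :=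
        mul_le_mul (natCast_factorial_le_exp_mul_log n)
          (by linarith [Real.add_one_le_exp (maxModulus g (K + 1))])
          (maxModulus_nonneg _ _) (Real.exp_nonneg _)
    _ ≤ _ := by
        rw [← Real.exp_add, Real.exp_le_exp]; linarith

/-- Derivatives of an entire function of given order grow at most at the rate `theta`, uniformly
on bounded sets. -/
theorem eventually_norm_iteratedDeriv_le_of_theta_order_lt {g : ℂ → ℂ} (hg : Differentiable ℂ g)
    {t : ℝ} (ht : theta (order g) < ENNReal.ofReal (Real.exp t)) (K : ℝ) :
    ∀ᶠ n : ℕ in atTop, ∀ z : ℂ, ‖z‖ ≤ K →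
      ‖iteratedDeriv n g z‖ ≤ Real.exp (t * ((n : ℝ) * Real.log n)) := by
  obtain ⟨s, hs, hst⟩ := ENNReal.exists_exp_btwn ht
  rw [ofReal_exp_lt_ofReal_exp] at hst
  by_cases h1 : s < 1
  · rw [← theta_inv_one_sub h1, theta_strictMono.lt_iff_lt] at hs
    refine eventually_norm_iteratedDeriv_le_of_order_lt hg hs ?_ K
    rw [one_div_one_div]; linarith
  · exact eventually_norm_iteratedDeriv_le_of_one_lt hg (by linarith) K

theorem hasSum_taylorCoeff {g : ℂ → ℂ} (hg : Differentiable ℂ g) (z w : ℂ) :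
    HasSum (fun n : ℕ => taylorCoeff g n z * (w - z) ^ n) (g w) := by
  convert! Complex.hasSum_taylorSeries_of_entire hg z w using 2 with n
  simp only [taylorCoeff, smul_eq_mul]
  ring

theorem eventually_norm_taylorCoeff_lt_one {g : ℂ → ℂ} (hg : Differentiable ℂ g) (z : ℂ) :
    ∀ᶠ n : ℕ in atTop, ‖taylorCoeff g n z‖ < 1 := by
  have h := (hasSum_taylorCoeff hg z (z + 1)).summable.tendsto_atTop_zero.norm
  simp only [add_sub_cancel_left, one_pow, mul_one, norm_zero] at h
  exact h.eventually (gt_mem_nhds one_pos)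

theorem norm_le_of_norm_taylorCoeff_mul_pow_le {g : ℂ → ℂ} (hg : Differentiable ℂ g) {z w : ℂ}
    {R B : ℝ} (hw : ‖w - z‖ ≤ R)
    (h : ∀ n, ‖taylorCoeff g n z‖ * R ^ n ≤ (1 / 2) ^ n * B) : ‖g w‖ ≤ 2 * B := by
  rw [← (hasSum_taylorCoeff hg z w).tsum_eq]
  refine tsum_of_norm_bounded (hasSum_geometric_two.mul_right B) fun n => ?_
  rw [norm_mul, norm_pow]
  refine le_trans ?_ (h n)
  gcongr

/-- The coefficient is at most `e^n n^(-n/σ)`, so the left side is at most `2^(-n) (L / n^(1/σ))^n`.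
The last power is at most 1 if `L ≤ n^(1/σ)`; otherwise `n ≤ L^σ` and it is at most `L^n`. -/
theorem norm_taylorCoeff_mul_pow_le {g : ℂ → ℂ} {z : ℂ} {σ : ℝ} (hσ : 0 < σ) {n : ℕ} (hn : 0 < n)
    (h : ‖iteratedDeriv n g z‖ ≤ Real.exp ((1 - 1 / σ) * ((n : ℝ) * Real.log n)))
    {L : ℝ} (hL : 1 ≤ L) :
    ‖taylorCoeff g n z‖ * (L / (2 * Real.exp 1)) ^ n ≤ (1 / 2) ^ n * L ^ (L ^ σ) := by
  have hn' : (0 : ℝ) < n := by exact_mod_cast hn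
  have hL0 : 0 < L := by linarith
  have hs : Real.exp (1 / σ * ((n : ℝ) * Real.log n)) = ((n : ℝ) ^ (1 / σ)) ^ n := by
    rw [← Real.rpow_natCast, ← Real.rpow_mul hn'.le, Real.rpow_def_of_pos hn']
    ring_nf
  have hb : 0 < (n : ℝ) ^ (1 / σ) := Real.rpow_pos_of_pos hn' _
  have h1 : ‖taylorCoeff g n z‖ ≤ Real.exp n / ((n : ℝ) ^ (1 / σ)) ^ n := by
    rw [taylorCoeff, norm_div, Complex.norm_natCast, div_le_iff₀ (by positivity), ← hs]
    refine h.trans ?_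
    rw [sub_mul, one_mul, Real.exp_sub, div_mul_eq_mul_div (Real.exp n)]
    refine div_le_div_of_nonneg_right ?_ (Real.exp_nonneg _)
    rw [mul_comm (Real.exp n)]
    exact exp_mul_log_le_natCast_factorial_mul_exp n
  have h2 : Real.exp n / ((n : ℝ) ^ (1 / σ)) ^ n * (L / (2 * Real.exp 1)) ^ n
      = (1 / 2) ^ n * (L / (n : ℝ) ^ (1 / σ)) ^ n := by
    have : Real.exp n = Real.exp 1 ^ n := by rw [← Real.exp_nat_mul, mul_one]
    rw [this, ← div_pow, ← mul_pow, ← mul_pow]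
    congr 1
    field_simp
  calc ‖taylorCoeff g n z‖ * (L / (2 * Real.exp 1)) ^ n
      ≤ Real.exp n / ((n : ℝ) ^ (1 / σ)) ^ n * (L / (2 * Real.exp 1)) ^ n := by gcongr
    _ = (1 / 2) ^ n * (L / (n : ℝ) ^ (1 / σ)) ^ n := h2
    _ ≤ (1 / 2) ^ n * L ^ (L ^ σ) := by
      gcongr
      by_cases hc : L ≤ (n : ℝ) ^ (1 / σ)
      · exact (pow_le_one₀ (by positivity) ((div_le_one hb).2 hc)).trans
          (Real.one_le_rpow hL (by positivity))
      · have h3 : (n : ℝ) ≤ L ^ σ := by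
          have := Real.rpow_le_rpow hb.le (not_le.1 hc).le hσ.le
          rwa [← Real.rpow_mul hn'.le, one_div_mul_cancel hσ.ne', Real.rpow_one] at this
        have h4 : 1 ≤ (n : ℝ) ^ (1 / σ) :=
          Real.one_le_rpow (by exact_mod_cast hn) (by positivity)
        calc (L / (n : ℝ) ^ (1 / σ)) ^ n ≤ L ^ n := by
              gcongr
              exact div_le_self hL0.le h4
          _ = L ^ (n : ℝ) := (Real.rpow_natCast _ _).symm
          _ ≤ L ^ (L ^ σ) := Real.rpow_le_rpow_of_exponent_le hL h3

theorem exists_maxModulus_le {g : ℂ → ℂ} (hg : Differentiable ℂ g) {z : ℂ} {σ : ℝ} (hσ : 0 < σ)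
    (h : ∀ᶠ n : ℕ in atTop, ‖iteratedDeriv n g z‖ ≤
      Real.exp ((1 - 1 / σ) * ((n : ℝ) * Real.log n))) :
    ∃ (C : ℝ) (N : ℕ), 0 < C ∧ ∀ r : ℝ, 0 ≤ r →
      maxModulus g r ≤ C * (2 * Real.exp 1 * (r + ‖z‖ + 1)) ^
        ((N : ℝ) + (2 * Real.exp 1 * (r + ‖z‖ + 1)) ^ σ) := by
  obtain ⟨N, hN⟩ := eventually_atTop.1 (h.and (eventually_gt_atTop 0))
  set A : ℝ := ∑ n ∈ Finset.range N, ‖taylorCoeff g n z‖ with hA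
  have hA0 : 0 ≤ A := Finset.sum_nonneg fun _ _ => norm_nonneg _
  -- The terms with `n < N` are covered by `A L^N`; the factor `2^N` offsets the geometric weight
  -- `2^(-n)`.
  refine ⟨2 * (1 + A * 2 ^ N), N, by positivity, fun r hr => ?_⟩
  set L : ℝ := 2 * Real.exp 1 * (r + ‖z‖ + 1) with hLdef
  have he : (1 : ℝ) ≤ Real.exp 1 := by linarith [Real.add_one_le_exp 1]
  have hR1 : (1 : ℝ) ≤ r + ‖z‖ + 1 := by linarith [norm_nonneg z]
  have hLR : r + ‖z‖ + 1 = L / (2 * Real.exp 1) := by rw [hLdef]; field_simp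
  have hRL : r + ‖z‖ + 1 ≤ L := by rw [hLdef]; nlinarith
  have hL : 1 ≤ L := hR1.trans hRL
  have hL0 : 0 < L := by linarith
  refine maxModulus_le (by positivity) fun w hw => ?_
  rw [mul_assoc]
  refine norm_le_of_norm_taylorCoeff_mul_pow_le hg (z := z) (R := r + ‖z‖ + 1)
    (by linarith [norm_sub_le w z]) fun n => ?_
  have hLN : (1 : ℝ) ≤ L ^ (N : ℝ) := Real.one_le_rpow hL (by positivity)
  have hLL : (1 : ℝ) ≤ L ^ (L ^ σ) := Real.one_le_rpow hL (by positivity)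
  rw [Real.rpow_add hL0]
  rcases lt_or_ge n N with hn | hn
  · have h1 : ‖taylorCoeff g n z‖ ≤ A :=
      Finset.single_le_sum (f := fun n => ‖taylorCoeff g n z‖) (fun _ _ => norm_nonneg _)
        (Finset.mem_range.2 hn)
    have h2 : (r + ‖z‖ + 1) ^ n ≤ L ^ (N : ℝ) := by
      rw [Real.rpow_natCast]
      exact (pow_le_pow_left₀ (by linarith) hRL n).trans (pow_le_pow_right₀ hL hn.le)
    have h3 : (1 : ℝ) ≤ (1 / 2) ^ n * 2 ^ N := by
      calc (1 : ℝ) = (1 / 2) ^ n * 2 ^ n := by rw [← mul_pow]; norm_num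
        _ ≤ _ := by gcongr; norm_num
    calc ‖taylorCoeff g n z‖ * (r + ‖z‖ + 1) ^ n ≤ A * L ^ (N : ℝ) := by gcongr
      _ ≤ (A * L ^ (N : ℝ)) * ((1 / 2) ^ n * 2 ^ N) * L ^ (L ^ σ) :=
        (le_mul_of_one_le_right (by positivity) h3).trans
          (le_mul_of_one_le_right (by positivity) hLL)
      _ ≤ (1 / 2) ^ n * ((1 + A * 2 ^ N) * (L ^ (N : ℝ) * L ^ (L ^ σ))) := by
        have : 0 ≤ (1 / 2 : ℝ) ^ n * (L ^ (N : ℝ) * L ^ (L ^ σ)) := by positivity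
        nlinarith
  · have h1 := norm_taylorCoeff_mul_pow_le hσ (hN n hn).2 (hN n hn).1 hL
    rw [← hLR] at h1
    refine h1.trans ?_
    gcongr
    have h2 : 1 ≤ (1 + A * 2 ^ N) * L ^ (N : ℝ) :=
      one_le_mul_of_one_le_of_one_le (by linarith [mul_nonneg hA0 (pow_nonneg zero_le_two N)]) hLN
    rw [← mul_assoc]
    exact le_mul_of_one_le_left (by linarith) h2

/-- The logarithm of the left side is `O(r^σ ln r)`, which is `o(r^τ)`. -/
theorem eventually_mul_rpow_rpow_le {σ τ : ℝ} (hσ : 0 < σ) (hστ : σ < τ) {C : ℝ} (hC : 0 < C)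
    (N : ℕ) {a : ℝ} (ha : 0 < a) (b : ℝ) :
    ∀ᶠ r : ℝ in atTop,
      C * (a * (r + b)) ^ ((N : ℝ) + (a * (r + b)) ^ σ) ≤ Real.exp (r ^ τ) := by
  set c : ℝ := 2 * a
  set K : ℝ := |Real.log C| + 2 * (1 + c ^ σ)
  have hc : 0 < c := by positivity
  have hK : 0 < K := by positivity
  have hlog : ∀ᶠ r : ℝ in atTop, ‖Real.log r‖ ≤ 1 / K * ‖r ^ (τ - σ)‖ :=
    (isLittleO_log_rpow_atTop (by linarith : 0 < τ - σ)).def (by positivity)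
  filter_upwards [hlog, eventually_gt_atTop |b|, eventually_ge_atTop c,
    eventually_ge_atTop (Real.exp 1), (tendsto_rpow_atTop hσ).eventually_ge_atTop (max 1 (N : ℝ))]
    with r h1 h2 h3 h4 h5
  have hr0 : 0 < r := (Real.exp_pos 1).trans_le h4
  have hl1 : 1 ≤ Real.log r := (Real.le_log_iff_exp_le hr0).2 h4
  have hrb : 0 < r + b := by linarith [neg_abs_le b]
  have hL0 : 0 < a * (r + b) := by positivity
  have hLc : a * (r + b) ≤ c * r := by
    have : r + b ≤ 2 * r := by linarith [le_abs_self b]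
    calc a * (r + b) ≤ a * (2 * r) := by gcongr
      _ = c * r := by ring
  have hlogL : Real.log (a * (r + b)) ≤ 2 * Real.log r := by
    refine (Real.log_le_log hL0 (hLc.trans (mul_le_mul_of_nonneg_right h3 hr0.le))).trans_eq ?_
    rw [Real.log_mul hr0.ne' hr0.ne']; ring
  have hLσ : (a * (r + b)) ^ σ ≤ c ^ σ * r ^ σ := by
    rw [← Real.mul_rpow hc.le hr0.le]
    exact Real.rpow_le_rpow hL0.le hLc hσ.le
  have hr1 : 1 ≤ r ^ σ := (le_max_left _ _).trans h5
  have hrN : (N : ℝ) ≤ r ^ σ := (le_max_right _ _).trans h5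
  have hcσ : 0 < c ^ σ := Real.rpow_pos_of_pos hc σ
  have key : r ^ σ * Real.log r * K ≤ r ^ τ := by
    rw [Real.norm_of_nonneg (by linarith), Real.norm_of_nonneg (by positivity), one_div,
      inv_mul_eq_div, le_div_iff₀ hK] at h1
    calc r ^ σ * Real.log r * K = r ^ σ * (Real.log r * K) := by ring
      _ ≤ r ^ σ * r ^ (τ - σ) := by gcongr
      _ = r ^ τ := by rw [← Real.rpow_add hr0]; ring_nf
  rw [Real.rpow_def_of_pos hL0]
  nth_rewrite 1 [← Real.exp_log hC]
  rw [← Real.exp_add, Real.exp_le_exp]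
  refine le_trans ?_ key
  have e1 : Real.log C ≤ r ^ σ * Real.log r * |Real.log C| :=
    (le_abs_self _).trans (le_mul_of_one_le_left (abs_nonneg _)
      (one_le_mul_of_one_le_of_one_le hr1 hl1))
  have e2 : Real.log (a * (r + b)) * ((N : ℝ) + (a * (r + b)) ^ σ)
      ≤ 2 * Real.log r * (r ^ σ + c ^ σ * r ^ σ) := by
    gcongr
  calc _ ≤ r ^ σ * Real.log r * |Real.log C| + 2 * Real.log r * (r ^ σ + c ^ σ * r ^ σ) :=
        add_le_add e1 e2
    _ = _ := by ring

/-- The growth of the derivatives at one point bounds the order of an entire function. -/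
theorem theta_order_le_of_eventually_norm_iteratedDeriv_le {g : ℂ → ℂ} (hg : Differentiable ℂ g)
    {z : ℂ} {t : ℝ} (h : ∀ᶠ n : ℕ in atTop, ‖iteratedDeriv n g z‖ ≤
      Real.exp (t * ((n : ℝ) * Real.log n))) :
    theta (order g) ≤ ENNReal.ofReal (Real.exp t) := by
  rcases le_or_gt 1 t with ht | ht
  · exact (theta_le _).trans (ENNReal.ofReal_le_ofReal (Real.exp_le_exp.2 ht))
  set σ : ℝ := 1 / (1 - t) with hσdef
  have hσ : 0 < σ := one_div_pos.2 (by linarith)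
  have hts : t = 1 - 1 / σ := by rw [hσdef, one_div_one_div]; ring
  rw [← theta_inv_one_sub ht, ← hσdef]
  refine theta_strictMono.monotone ?_
  rw [hts] at h
  obtain ⟨C, N, hC, hM⟩ := exists_maxModulus_le hg hσ h
  refine ENNReal.le_of_forall_pos_le_add fun ε hε _ => ?_
  rw [← ENNReal.ofReal_coe_nnreal, ← ENNReal.ofReal_add hσ.le ε.coe_nonneg]
  have hε' : (0 : ℝ) < ε := hε
  refine order_le_of_eventually_maxModulus_le (by linarith) ?_
  filter_upwards [eventually_ge_atTop 0, eventually_mul_rpow_rpow_le hσ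
    (by linarith : σ < σ + ε) hC N (by positivity : 0 < 2 * Real.exp 1) (‖z‖ + 1)] with r h0 h1
  refine (hM r h0).trans ?_
  rwa [add_assoc]

end EntireFn

/-! ### Two-constants estimates. -/

/-- In Jensen's formula each zero `u` contributes its multiplicity times `ln(R/|c - u|) ≥ 0`. -/
theorem log_norm_le_circleAverage_log_norm {f : ℂ → ℂ} (hf : Differentiable ℂ f) {c : ℂ} {R : ℝ}
    (hR : 0 < R) (hc : f c ≠ 0) :
    Real.log ‖f c‖ ≤ Real.circleAverage (fun z => Real.log ‖f z‖) c R := by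
  have hA : AnalyticOnNhd ℂ f (Metric.closedBall c |R|) := fun z _ => hf.analyticAt z
  rw [hA.circleAverage_log_norm hR.ne' hc]
  refine le_add_of_nonneg_left (finsum_nonneg fun u => ?_)
  by_cases hu : u ∈ Metric.closedBall c |R|
  · refine mul_nonneg ?_ ?_
    · exact_mod_cast MeromorphicOn.AnalyticOnNhd.divisor_nonneg hA u
    · rcases eq_or_ne u c with rfl | huc
      · simp
      · have h1 : 0 < ‖c - u‖ := norm_pos_iff.2 (sub_ne_zero.2 huc.symm)
        refine Real.log_nonneg ?_
        rw [← div_eq_mul_inv, one_le_div h1]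
        rw [Metric.mem_closedBall', dist_eq_norm, abs_of_pos hR] at hu
        exact hu
  · rw [Function.locallyFinsuppWithin.apply_eq_zero_of_notMem _ hu]
    simp

theorem circleIntegrable_indicator_one {S : Set ℂ} (hS : MeasurableSet S) (c : ℂ) (R : ℝ) :
    CircleIntegrable (S.indicator fun _ => (1 : ℝ)) c R := by
  unfold CircleIntegrable
  refine (intervalIntegrable_const (c := (1 : ℝ))).mono_fun ?_ ?_
  · exact ((measurable_const.indicator hS).comp
      (continuous_circleMap c R).measurable).aestronglyMeasurable
  · refine Eventually.of_forall fun θ => ?_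
    by_cases h : circleMap c R θ ∈ S <;> simp [h]

/-- Two-constants estimate on a circle. -/
theorem log_norm_le_mul_circleAverage_indicator {f : ℂ → ℂ} (hf : Differentiable ℂ f) {c : ℂ}
    {R B : ℝ} (hR : 0 < R) (hc : f c ≠ 0) (hB : 1 ≤ B) {E : Set ℂ} (hE : MeasurableSet E)
    (h1 : ∀ z ∈ E, ‖f z‖ ≤ 1) (h2 : ∀ z, ‖z - c‖ ≤ R → ‖f z‖ ≤ B) :
    Real.log ‖f c‖ ≤ Real.log B * Real.circleAverage (Eᶜ.indicator fun _ => (1 : ℝ)) c R := by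
  have hI := circleIntegrable_indicator_one hE.compl c R
  refine (log_norm_le_circleAverage_log_norm hf hR hc).trans ?_
  rw [← smul_eq_mul, ← Real.circleAverage_smul]
  have hlogB : 0 ≤ Real.log B := Real.log_nonneg hB
  refine Real.circleAverage_mono ?_ (hI.const_smul) ?_
  · exact MeromorphicOn.circleIntegrable_log_norm fun z _ => (hf.analyticAt z).meromorphicAt
  · intro z hz
    rw [abs_of_pos hR, mem_sphere_iff_norm] at hz
    by_cases hzE : z ∈ E
    · simpa [hzE] using Real.log_nonpos (norm_nonneg _) (h1 z hzE)
    · have hzc : z ∈ Eᶜ := hzE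
      simp only [Pi.smul_apply, Set.indicator_of_mem hzc, smul_eq_mul, mul_one]
      rcases eq_or_ne (f z) 0 with h0 | h0
      · simpa [h0] using hlogB
      · exact Real.log_le_log (norm_pos_iff.2 h0) (h2 z hz.le)

/-- Polar coordinates about `c`; this turns the circle estimate into one by area. -/
theorem setIntegral_Ioo_mul_circleAverage_indicator {S : Set ℂ} (hS : MeasurableSet S) (c : ℂ)
    (R : ℝ) :
    ∫ r in Set.Ioo 0 R, r * Real.circleAverage (S.indicator fun _ => (1 : ℝ)) c r =
      (2 * Real.pi)⁻¹ * volume.real (S ∩ Metric.ball c R) := by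
  set F : ℂ → ℝ := (S ∩ Metric.ball c R).indicator fun _ => (1 : ℝ) with hF
  have hSm : MeasurableSet (S ∩ Metric.ball c R) := hS.inter Metric.isOpen_ball.measurableSet
  have h1 : ∫ z, F (z + c) = volume.real (S ∩ Metric.ball c R) := by
    rw [integral_add_right_eq_self F c, hF, integral_indicator_const _ hSm, smul_eq_mul, mul_one]
  rw [← h1, ← Complex.integral_comp_polarCoord_symm, polarCoord_target]
  have hpt : ∀ p ∈ Set.Ioi (0 : ℝ) ×ˢ Set.Ioo (-Real.pi) Real.pi,
      p.1 • F (Complex.polarCoord.symm p + c) =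
        (Set.Ioo 0 R ×ˢ Set.univ).indicator
          (fun p : ℝ × ℝ => p.1 * S.indicator (fun _ => (1 : ℝ)) (circleMap c p.1 p.2)) p := by
    rintro ⟨r, θ⟩ ⟨hr, hθ⟩
    have hr : 0 < r := hr
    have e : Complex.polarCoord.symm (r, θ) + c = circleMap c r θ := by
      rw [Complex.polarCoord_symm_apply, circleMap, Complex.exp_mul_I]
      push_cast; ring
    rw [e, hF]
    have hb : circleMap c r θ ∈ Metric.ball c R ↔ r < R := by
      rw [mem_ball_iff_norm, circleMap_sub_center, norm_circleMap_zero, abs_of_pos hr]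
    by_cases hrR : r < R <;> by_cases hs : circleMap c r θ ∈ S <;>
      simp [Set.indicator, hb, hrR, hs, hr]
  rw [setIntegral_congr_fun (measurableSet_Ioi.prod measurableSet_Ioo) hpt,
    setIntegral_indicator (measurableSet_Ioo.prod MeasurableSet.univ), Set.prod_inter_prod,
    Set.inter_univ, Set.inter_eq_self_of_subset_right Set.Ioo_subset_Ioi_self]
  have hcm : Measurable fun p : ℝ × ℝ => circleMap c p.1 p.2 := by
    unfold circleMap; fun_prop
  rw [Measure.volume_eq_prod, setIntegral_prod, ← integral_const_mul]
  · refine setIntegral_congr_fun measurableSet_Ioo fun r _ => ?_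
    simp only
    rw [integral_const_mul, Real.circleAverage_eq_integral_add (-Real.pi),
      intervalIntegral.integral_comp_add_right
        (fun θ => S.indicator (fun _ => (1 : ℝ)) (circleMap c r θ)),
      intervalIntegral.integral_of_le (by linarith [Real.pi_pos]), integral_Ioc_eq_integral_Ioo,
      smul_eq_mul]
    have : 2 * Real.pi + -Real.pi = Real.pi := by ring
    rw [this, zero_add]
    ring
  · refine Measure.integrableOn_of_bounded (M := |R|) ?_ ?_ ?_
    · rw [Measure.prod_prod]
      simp [ENNReal.mul_eq_top]
    · exact (measurable_fst.mul ((measurable_const.indicator hS).comp hcm)).aestronglyMeasurable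
    · refine (ae_restrict_iff' (measurableSet_Ioo.prod measurableSet_Ioo)).2
        (Eventually.of_forall ?_)
      rintro ⟨r, θ⟩ ⟨hr, -⟩
      have hr1 : 0 < r := hr.1
      have hr2 : r < R := hr.2
      by_cases hs : circleMap c r θ ∈ S <;>
        simp [hs, abs_of_pos hr1, abs_of_pos (hr1.trans hr2), hr2.le, (hr1.trans hr2).le]

/-- Two-constants estimate with respect to area on a disc. -/
theorem log_norm_mul_area_le {f : ℂ → ℂ} (hf : Differentiable ℂ f) {c : ℂ}
    {R B : ℝ} (hR : 0 < R) (hc : f c ≠ 0) (hB : 1 ≤ B) {E : Set ℂ} (hE : MeasurableSet E)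
    (h1 : ∀ z ∈ E, ‖f z‖ ≤ 1) (h2 : ∀ z, ‖z - c‖ ≤ R → ‖f z‖ ≤ B) :
    Real.log ‖f c‖ * (Real.pi * R ^ 2) ≤ Real.log B * volume.real (Eᶜ ∩ Metric.ball c R) := by
  set A : ℝ → ℝ := fun r => Real.circleAverage (Eᶜ.indicator fun _ => (1 : ℝ)) c r with hA
  have hlogB : 0 ≤ Real.log B := Real.log_nonneg hB
  have hid := setIntegral_Ioo_mul_circleAverage_indicator hE.compl c R
  have hl : ∫ r in Set.Ioo 0 R, r * Real.log ‖f c‖ = R ^ 2 / 2 * Real.log ‖f c‖ := by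
    rw [integral_mul_const, ← integral_Ioc_eq_integral_Ioo,
      ← intervalIntegral.integral_of_le hR.le, integral_id]
    ring
  have hmeas : AEStronglyMeasurable (fun r => r * A r) volume := by
    refine aestronglyMeasurable_id.mul ?_
    have hcm : Measurable fun p : ℝ × ℝ => circleMap c p.1 p.2 := by
      unfold circleMap; fun_prop
    have : StronglyMeasurable fun r : ℝ =>
        ∫ θ in Set.Ioc 0 (2 * Real.pi), Eᶜ.indicator (fun _ => (1 : ℝ)) (circleMap c r θ) :=
      StronglyMeasurable.integral_prod_right
        (f := fun r θ : ℝ => Eᶜ.indicator (fun _ => (1 : ℝ)) (circleMap c r θ))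
        ((measurable_const.indicator hE.compl).comp hcm).stronglyMeasurable
    have hA' : A = fun r => (2 * Real.pi)⁻¹ * ∫ θ in Set.Ioc 0 (2 * Real.pi),
        Eᶜ.indicator (fun _ => (1 : ℝ)) (circleMap c r θ) := by
      ext r
      simp only [hA]
      rw [Real.circleAverage_def, intervalIntegral.integral_of_le (by positivity), smul_eq_mul]
    rw [hA']
    exact (this.const_mul _).aestronglyMeasurable
  have hA0 : ∀ r, 0 ≤ A r ∧ A r ≤ 1 := by
    intro r
    have hI := circleIntegrable_indicator_one hE.compl c r
    constructor
    · refine Real.circleAverage_nonneg_of_nonneg fun z _ => ?_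
      exact Set.indicator_nonneg (fun _ _ => zero_le_one) z
    · refine Real.circleAverage_mono_on_of_le_circle hI fun z _ => ?_
      exact Set.indicator_le_self' (fun _ _ => zero_le_one) z
  have hint : IntegrableOn (fun r => r * A r) (Set.Ioo 0 R) := by
    refine Measure.integrableOn_of_bounded (M := R) (by simp) hmeas ?_
    refine (ae_restrict_iff' measurableSet_Ioo).2 (Eventually.of_forall fun r hr => ?_)
    rw [norm_mul, Real.norm_of_nonneg hr.1.le, Real.norm_of_nonneg (hA0 r).1]
    nlinarith [hr.1, hr.2, hA0 r]
  have hmono : ∫ r in Set.Ioo 0 R, r * Real.log ‖f c‖ ≤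
      ∫ r in Set.Ioo 0 R, Real.log B * (r * A r) := by
    refine setIntegral_mono_on ?_ (hint.const_mul _) measurableSet_Ioo fun r hr => ?_
    · exact ((continuous_id.mul continuous_const).integrableOn_Icc (a := 0) (b := R)).mono_set
        Set.Ioo_subset_Icc_self
    · have := log_norm_le_mul_circleAverage_indicator hf hr.1 hc hB hE h1
        fun z hz => h2 z (hz.trans hr.2.le)
      calc r * Real.log ‖f c‖ ≤ r * (Real.log B * A r) :=
            mul_le_mul_of_nonneg_left this hr.1.le
        _ = _ := by ring
  rw [hl, integral_const_mul, hid] at hmono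
  have hpi := Real.pi_pos
  calc Real.log ‖f c‖ * (Real.pi * R ^ 2)
      = 2 * Real.pi * (R ^ 2 / 2 * Real.log ‖f c‖) := by ring
    _ ≤ 2 * Real.pi * (Real.log B *
          ((2 * Real.pi)⁻¹ * volume.real (Eᶜ ∩ Metric.ball c R))) := by gcongr
    _ = _ := by field_simp

/-- Two-constants estimate near the centre of a disc, with a set of positive area. -/
theorem norm_le_exp_of_two_constants {f : ℂ → ℂ} (hf : Differentiable ℂ f) {R a b : ℝ}
    (hR : 0 < R) (hab : a ≤ b) {E : Set ℂ} (hE : MeasurableSet E)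
    (h1 : ∀ z ∈ E, ‖f z‖ ≤ Real.exp a) (h2 : ∀ z, ‖z‖ ≤ R + 2 → ‖f z‖ ≤ Real.exp b)
    {w : ℂ} (hw : ‖w‖ ≤ 1) :
    ‖f w‖ ≤ Real.exp (a + (1 - volume.real (E ∩ Metric.ball 0 R) / (Real.pi * (R + 1) ^ 2)) *
      (b - a)) := by
  rcases eq_or_ne (f w) 0 with h0 | h0
  · rw [h0, norm_zero]; exact Real.exp_nonneg _
  -- For `|w| ≤ 1` this disc contains the ball of radius `R` about 0 and lies in the one of radius
  -- `R + 2`.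
  set D : Set ℂ := Metric.ball w (R + 1) with hD
  have hsub : Metric.ball (0 : ℂ) R ⊆ D := by
    refine Metric.ball_subset_ball' ?_
    rw [dist_zero_left]; linarith
  have hDfin : volume D ≠ ∞ := Metric.isBounded_ball.measure_lt_top.ne
  have hDvol : volume.real D = Real.pi * (R + 1) ^ 2 := by
    rw [Measure.real, hD, Complex.volume_ball]
    simp [ENNReal.toReal_ofReal (by linarith : 0 ≤ R + 1), mul_comm]
  have hvol : volume.real (Eᶜ ∩ D) ≤
      Real.pi * (R + 1) ^ 2 - volume.real (E ∩ Metric.ball 0 R) := by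
    have e1 : volume.real (D ∩ E) + volume.real (D \ E) = volume.real D :=
      measureReal_inter_add_sdiff hE hDfin
    have e2 : volume.real (E ∩ Metric.ball 0 R) ≤ volume.real (D ∩ E) :=
      measureReal_mono (fun z hz => ⟨hsub hz.2, hz.1⟩)
        (measure_ne_top_of_subset Set.inter_subset_left hDfin)
    have e3 : Eᶜ ∩ D = D \ E := by rw [Set.inter_comm]; rfl
    rw [e3]; linarith
  have hc : ∀ z, ‖(Real.exp (-a) : ℂ) * f z‖ = Real.exp (-a) * ‖f z‖ := fun z => by
    rw [norm_mul, Complex.norm_real, Real.norm_of_nonneg (Real.exp_nonneg _)]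
  have key := log_norm_mul_area_le (f := fun z => (Real.exp (-a) : ℂ) * f z) (c := w)
    (R := R + 1) (B := Real.exp (b - a)) (hf.const_mul _) (by linarith)
    (mul_ne_zero (by exact_mod_cast (Real.exp_pos _).ne') h0)
    (Real.one_le_exp (by linarith)) hE
    (fun z hz => by
      rw [hc]
      calc Real.exp (-a) * ‖f z‖ ≤ Real.exp (-a) * Real.exp a := by gcongr; exact h1 z hz
        _ = 1 := by rw [← Real.exp_add]; simp)
    (fun z hz => by
      rw [hc]
      have hz' : ‖z‖ ≤ R + 2 := by
        calc ‖z‖ = ‖(z - w) + w‖ := by ring_nf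
          _ ≤ ‖z - w‖ + ‖w‖ := norm_add_le _ _
          _ ≤ R + 2 := by linarith
      calc Real.exp (-a) * ‖f z‖ ≤ Real.exp (-a) * Real.exp b := by gcongr; exact h2 z hz'
        _ = Real.exp (b - a) := by rw [← Real.exp_add]; ring_nf)
  have hpos : 0 < ‖f w‖ := norm_pos_iff.2 h0
  rw [hc, Real.log_exp, Real.log_mul (Real.exp_pos _).ne' hpos.ne', Real.log_exp] at key
  have hA : 0 < Real.pi * (R + 1) ^ 2 := by positivity
  rw [← Real.log_le_iff_le_exp hpos, one_sub_div hA.ne', div_mul_eq_mul_div, ← sub_le_iff_le_add',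
    le_div_iff₀ hA]
  have := mul_le_mul_of_nonneg_left hvol (by linarith : 0 ≤ b - a)
  linarith

/-! ### Derivatives of one parity, and the exceptional null set. -/

theorem succ_mul_log_succ_sub_le {n : ℕ} (hn : 0 < n) :
    0 ≤ ((n + 1 : ℕ) : ℝ) * Real.log (n + 1 : ℕ) - n * Real.log n ∧
      ((n + 1 : ℕ) : ℝ) * Real.log (n + 1 : ℕ) - n * Real.log n ≤ (n + 1 : ℕ) + 1 := by
  have hn' : (0 : ℝ) < n := by exact_mod_cast hn
  have h1 : (1 : ℝ) ≤ n := by exact_mod_cast hn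
  push_cast
  have hl : Real.log n ≤ Real.log (n + 1) := Real.log_le_log hn' (by linarith)
  have hl0 : 0 ≤ Real.log n := Real.log_nonneg h1
  have hu : Real.log (n + 1) - Real.log n ≤ 1 / n := by
    rw [← Real.log_div (by linarith) hn'.ne']
    refine (Real.log_le_sub_one_of_pos (by positivity)).trans_eq ?_
    field_simp; ring
  have hu' : (n : ℝ) * (Real.log (n + 1) - Real.log n) ≤ 1 := by
    calc (n : ℝ) * (Real.log (n + 1) - Real.log n) ≤ n * (1 / n) := by gcongr
      _ = 1 := by field_simp
  have hs : Real.log (n + 1) ≤ n := by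
    simpa using Real.log_le_sub_one_of_pos (by linarith : (0 : ℝ) < n + 1)
  constructor
  · nlinarith
  · nlinarith

/-- The weight grows by `O(n)` per step, which the gap `t - s` absorbs; `|s|` enters because `s` may
be negative. -/
theorem eventually_mul_log_le_succ_mul_log_succ {s t : ℝ} (hst : s < t) :
    ∀ᶠ n : ℕ in atTop,
      s * ((n : ℝ) * Real.log n) ≤ t * (((n + 1 : ℕ) : ℝ) * Real.log (n + 1 : ℕ)) := by
  filter_upwards [eventually_gt_atTop 0, (tendsto_add_atTop_nat 1).eventually
    (eventually_mul_add_le_natCast_mul_log hst |s| |s|)] with n hn h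
  obtain ⟨h0, h1⟩ := succ_mul_log_succ_sub_le hn
  refine le_trans ?_ h
  have := mul_le_mul_of_nonneg_left h1 (abs_nonneg s)
  have := mul_le_mul_of_nonneg_right (neg_abs_le s) h0
  linarith

theorem tendsto_two_mul_add_atTop (j : ℕ) : Tendsto (fun k : ℕ => 2 * k + j) atTop atTop :=
  tendsto_atTop_mono (fun k => show k ≤ 2 * k + j by omega) tendsto_id

namespace EntireFn

theorem differentiable_iteratedDeriv {g : ℂ → ℂ} (hg : Differentiable ℂ g) (n : ℕ) :
    Differentiable ℂ (iteratedDeriv n g) :=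
  (hg.contDiff (n := ⊤)).differentiable_iteratedDeriv n (by exact_mod_cast WithTop.coe_lt_top _)

/-- If every other derivative is small near the origin, then so are all derivatives there. -/
theorem theta_order_le_of_eventually_alternate {g : ℂ → ℂ} (hg : Differentiable ℂ g) (j : ℕ)
    {s : ℝ} (h : ∀ᶠ k : ℕ in atTop, ∀ w : ℂ, ‖w‖ ≤ 1 → ‖iteratedDeriv (2 * k + j) g w‖ ≤
      Real.exp (s * (((2 * k + j : ℕ) : ℝ) * Real.log (2 * k + j : ℕ)))) :
    theta (order g) ≤ ENNReal.ofReal (Real.exp s) := by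
  refine ENNReal.le_of_forall_lt_exp fun t hst => ?_
  rw [ofReal_exp_lt_ofReal_exp] at hst
  refine theta_order_le_of_eventually_norm_iteratedDeriv_le hg (z := 0) ?_
  obtain ⟨k₀, hk₀⟩ := eventually_atTop.1 (h.and ((tendsto_two_mul_add_atTop j).eventually
    ((eventually_natCast_mul_log_pos tendsto_id).and
      (eventually_mul_log_le_succ_mul_log_succ hst))))
  filter_upwards [eventually_ge_atTop (2 * k₀ + j)] with m hm
  obtain ⟨k, hk, hmk⟩ : ∃ k, k₀ ≤ k ∧ (m = 2 * k + j ∨ m = 2 * k + j + 1) :=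
    ⟨(m - j) / 2, by omega, by omega⟩
  obtain ⟨h1, h2, h3⟩ := hk₀ k hk
  rcases hmk with rfl | rfl
  · refine (h1 0 (by simp)).trans (Real.exp_le_exp.2 ?_)
    exact mul_le_mul_of_nonneg_right hst.le h2.le
  · rw [iteratedDeriv_succ]
    -- Cauchy's estimate on the unit circle bounds the derivative of the other parity at 0.
    have := Complex.norm_deriv_le_of_forall_mem_sphere_norm_le (c := 0) one_pos
      (differentiable_iteratedDeriv hg (2 * k + j)).diffContOnCl
      fun z hz => h1 z (by simpa using (mem_sphere_zero_iff_norm.1 hz).le)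
    rw [div_one] at this
    exact this.trans (Real.exp_le_exp.2 h3)

theorem theta_order_le_of_measure_ne_zero {g : ℂ → ℂ} (hg : Differentiable ℂ g) (j : ℕ)
    {t R : ℝ} (hR : 0 < R) {E : Set ℂ} (hE : MeasurableSet E)
    (hE0 : volume (E ∩ Metric.ball 0 R) ≠ 0)
    (h : ∀ᶠ k : ℕ in atTop, ∀ z ∈ E, ‖iteratedDeriv (2 * k + j) g z‖ ≤
      Real.exp (t * (((2 * k + j : ℕ) : ℝ) * Real.log (2 * k + j : ℕ)))) :
    theta (order g) ≤ ENNReal.ofReal (Real.exp t) := by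
  by_contra! hlt
  obtain ⟨τ, hτ⟩ : ∃ τ : ℝ, theta (order g) = ENNReal.ofReal (Real.exp τ) := by
    have h1 : theta (order g) ≠ ∞ := ((theta_le _).trans_lt ENNReal.ofReal_lt_top).ne
    refine ⟨Real.log (theta (order g)).toReal, ?_⟩
    rw [Real.exp_log (ENNReal.toReal_pos (bot_le.trans_lt hlt).ne' h1), ENNReal.ofReal_toReal h1]
  rw [hτ, ofReal_exp_lt_ofReal_exp] at hlt
  set ω : ℝ := volume.real (E ∩ Metric.ball 0 R) / (Real.pi * (R + 1) ^ 2) with hω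
  have hω0 : 0 < ω := by
    refine div_pos (ENNReal.toReal_pos hE0 ?_) (by positivity)
    exact measure_ne_top_of_subset Set.inter_subset_right
      Metric.isBounded_ball.measure_lt_top.ne
  -- Above `τ`, so that the global bound applies, yet close enough that `t + (1 - ω)(T - t) = τ -
  -- ω(1 + ω)(τ - t)/2 < τ`.
  set T : ℝ := τ + ω * (τ - t) / 2 with hT
  have hωt : 0 < ω * (τ - t) := mul_pos hω0 (by linarith)
  have hτT : theta (order g) < ENNReal.ofReal (Real.exp T) := by
    rw [hτ, ofReal_exp_lt_ofReal_exp]; linarith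
  have hs : t + (1 - ω) * (T - t) < τ := by
    have : 0 < ω * (ω * (τ - t)) := mul_pos hω0 hωt
    rw [hT]; nlinarith
  have hup := (tendsto_two_mul_add_atTop j).eventually
    (eventually_norm_iteratedDeriv_le_of_theta_order_lt hg hτT (R + 2))
  have hle := theta_order_le_of_eventually_alternate hg j (s := t + (1 - ω) * (T - t)) (by
    filter_upwards [h, hup, (tendsto_two_mul_add_atTop j).eventually
      (eventually_natCast_mul_log_pos tendsto_id)] with k h1 h2 h3 w hw
    have h3' : 0 < ((2 * k + j : ℕ) : ℝ) * Real.log (2 * k + j : ℕ) := h3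
    refine (norm_le_exp_of_two_constants (differentiable_iteratedDeriv hg (2 * k + j)) hR
      (mul_le_mul_of_nonneg_right (by linarith) h3'.le) hE h1 h2 hw).trans_eq ?_
    congr 1
    ring)
  rw [hτ, ENNReal.ofReal_le_ofReal_iff (Real.exp_nonneg _), Real.exp_le_exp] at hle
  linarith

/-- The set is covered by countably many pieces, each bounded and with a common starting index `N`;
a piece of positive area would bound the order too strongly. -/
theorem volume_setOf_eventually_norm_iteratedDeriv_le {g : ℂ → ℂ} (hg : Differentiable ℂ g)
    (j : ℕ) {t : ℝ} (ht : ENNReal.ofReal (Real.exp t) < theta (order g)) :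
    volume {z : ℂ | ∀ᶠ k : ℕ in atTop, ‖iteratedDeriv (2 * k + j) g z‖ ≤
      Real.exp (t * (((2 * k + j : ℕ) : ℝ) * Real.log (2 * k + j : ℕ)))} = 0 := by
  set E : ℕ → Set ℂ := fun N => {z | ∀ k ≥ N, ‖iteratedDeriv (2 * k + j) g z‖ ≤
      Real.exp (t * (((2 * k + j : ℕ) : ℝ) * Real.log (2 * k + j : ℕ)))} with hEdef
  have hE : ∀ N, MeasurableSet (E N) := by
    intro N
    have : E N = ⋂ k ≥ N, {z | ‖iteratedDeriv (2 * k + j) g z‖ ≤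
      Real.exp (t * (((2 * k + j : ℕ) : ℝ) * Real.log (2 * k + j : ℕ)))} := by
      ext z; simp [hEdef]
    rw [this]
    refine (isClosed_biInter fun k _ => ?_).measurableSet
    exact isClosed_le (differentiable_iteratedDeriv hg _).continuous.norm continuous_const
  refine measure_mono_null (t := ⋃ N : ℕ, ⋃ R : ℕ, E N ∩ Metric.ball 0 (R + 1)) ?_ ?_
  · intro z hz
    obtain ⟨N, hN⟩ := eventually_atTop.1 hz
    obtain ⟨R, hR⟩ := exists_nat_gt ‖z‖
    refine Set.mem_iUnion.2 ⟨N, Set.mem_iUnion.2 ⟨R, hN, ?_⟩⟩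
    rw [mem_ball_zero_iff]; linarith
  · refine measure_iUnion_null fun N => measure_iUnion_null fun R => ?_
    by_contra h0
    refine ht.not_ge (theta_order_le_of_measure_ne_zero hg j (by positivity) (hE N) h0 ?_)
    filter_upwards [eventually_ge_atTop N] with k hk z hz using hz k hk

theorem eventually_two_mul_mul_log_pos : ∀ᶠ k : ℕ in atTop, 0 < 2 * (k : ℝ) * Real.log k := by
  filter_upwards [eventually_natCast_mul_log_pos tendsto_id] with k hk
  have hk : 0 < (k : ℝ) * Real.log k := hk
  linarith

theorem derivLimsup_eq {g : ℂ → ℂ} (hg : Differentiable ℂ g) (z : ℂ) :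
    derivLimsup g z = theta (order g) := by
  have hw := eventually_natCast_mul_log_pos tendsto_id
  apply le_antisymm
  · refine ENNReal.le_of_forall_lt_exp fun t ht => limsup_root_le hw ?_
    filter_upwards [eventually_norm_iteratedDeriv_le_of_theta_order_lt hg ht ‖z‖] with n h
    exact h z le_rfl
  · exact ENNReal.le_of_forall_lt_exp fun t ht =>
      theta_order_le_of_eventually_norm_iteratedDeriv_le hg
        (eventually_norm_le_of_limsup_root_lt hw ht)

theorem limsup_alternate_eq_theta {g : ℂ → ℂ} (hg : Differentiable ℂ g) (j : ℕ) (z : ℂ) :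
    limsup (fun k : ℕ => ‖iteratedDeriv (2 * k + j) g z‖ₑ ^ (1 / (2 * (k : ℝ) * Real.log k)))
      atTop = theta (limsup (fun k : ℕ => orderQuotient g (2 * k + j) z) atTop) :=
  limsup_root_eq_theta_limsup (tendsto_two_mul_add_atTop j) eventually_two_mul_mul_log_pos
    (tendsto_mul_log_ratio j)
    ((tendsto_two_mul_add_atTop j).eventually (eventually_norm_taylorCoeff_lt_one hg z))

theorem ae_limsup_alternate_eq {g : ℂ → ℂ} (hg : Differentiable ℂ g) (j : ℕ) :
    ∀ᵐ z ∂(volume : Measure ℂ),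
      limsup (fun k : ℕ => ‖iteratedDeriv (2 * k + j) g z‖ₑ ^ (1 / (2 * (k : ℝ) * Real.log k)))
        atTop = theta (order g) := by
  have hw := eventually_natCast_mul_log_pos (tendsto_two_mul_add_atTop j)
  -- Rational exponents keep the union of exceptional null sets countable.
  have hae : ∀ᵐ z ∂(volume : Measure ℂ), ∀ q : ℚ,
      ENNReal.ofReal (Real.exp q) < theta (order g) →
      ¬ ∀ᶠ k : ℕ in atTop, ‖iteratedDeriv (2 * k + j) g z‖ ≤
        Real.exp (q * (((2 * k + j : ℕ) : ℝ) * Real.log (2 * k + j : ℕ))) := by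
    refine ae_all_iff.2 fun q => ?_
    by_cases hq : ENNReal.ofReal (Real.exp q) < theta (order g)
    · filter_upwards [measure_eq_zero_iff_ae_notMem.1
        (volume_setOf_eventually_norm_iteratedDeriv_le hg j hq)] with z hz _ using hz
    · exact Eventually.of_forall fun z h => absurd h hq
  filter_upwards [hae] with z hz
  apply le_antisymm
  · refine ENNReal.le_of_forall_lt_exp fun t ht => ?_
    obtain ⟨s, hs, hst⟩ := ENNReal.exists_exp_btwn ht
    rw [ofReal_exp_lt_ofReal_exp] at hst
    refine limsup_root_le eventually_two_mul_mul_log_pos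
      (eventually_norm_le_exp_of_weight_ratio eventually_two_mul_mul_log_pos
        (tendsto_mul_log_ratio j) hst ?_)
    filter_upwards [(tendsto_two_mul_add_atTop j).eventually
      (eventually_norm_iteratedDeriv_le_of_theta_order_lt hg hs ‖z‖)] with k h
    exact h z le_rfl
  · by_contra! hlt
    obtain ⟨s, hs, hs'⟩ := ENNReal.exists_exp_btwn hlt
    obtain ⟨t, hst, ht⟩ := ENNReal.exists_exp_btwn hs'
    rw [ofReal_exp_lt_ofReal_exp] at hst
    obtain ⟨q, hsq, hqt⟩ := exists_rat_btwn hst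
    refine hz q ((ofReal_exp_lt_ofReal_exp.2 hqt).trans ht) ?_
    refine eventually_norm_le_exp_of_weight_ratio hw ?_ hsq
      (eventually_norm_le_of_limsup_root_lt eventually_two_mul_mul_log_pos hs)
    simpa using (tendsto_mul_log_ratio j).inv₀ one_ne_zero

end EntireFn

theorem theorem1 (g : ℂ → ℂ) (hg : Differentiable ℂ g) :
    (∀ z : ℂ, EntireFn.derivLimsup g z = EntireFn.theta (EntireFn.order g)) ∧
    (∀ z : ℂ, EntireFn.derivLimsupEven g z = EntireFn.theta (EntireFn.orderEven g z)) ∧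
    (∀ z : ℂ, EntireFn.derivLimsupOdd g z = EntireFn.theta (EntireFn.orderOdd g z)) ∧
    (∀ᵐ z ∂(volume : Measure ℂ),
      EntireFn.derivLimsupEven g z = EntireFn.theta (EntireFn.order g) ∧
      EntireFn.derivLimsupOdd g z = EntireFn.theta (EntireFn.order g)) ∧
    (∀ᵐ z ∂(volume : Measure ℂ),
      EntireFn.orderEven g z = EntireFn.order g ∧
      EntireFn.orderOdd g z = EntireFn.order g) := by
  have heven : ∀ z, EntireFn.derivLimsupEven g z = EntireFn.theta (EntireFn.orderEven g z) :=
    -- Here `2 * k + 0` is `2 * k` by definition.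
    EntireFn.limsup_alternate_eq_theta hg 0
  have hodd : ∀ z, EntireFn.derivLimsupOdd g z = EntireFn.theta (EntireFn.orderOdd g z) :=
    EntireFn.limsup_alternate_eq_theta hg 1
  have hae : ∀ᵐ z ∂(volume : Measure ℂ),
      EntireFn.derivLimsupEven g z = EntireFn.theta (EntireFn.order g) ∧
      EntireFn.derivLimsupOdd g z = EntireFn.theta (EntireFn.order g) :=
    (EntireFn.ae_limsup_alternate_eq hg 0).and (EntireFn.ae_limsup_alternate_eq hg 1)
  refine ⟨EntireFn.derivLimsup_eq hg, heven, hodd, hae, ?_⟩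
  filter_upwards [hae] with z hz
  rw [heven, hodd] at hz
  exact ⟨EntireFn.theta_strictMono.injective hz.1, EntireFn.theta_strictMono.injective hz.2⟩
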